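/- Let $\ell>0$, $m\ge 0$ and let $\beta_1,\beta_2,\beta_1',\beta_2'$ be real numbers with $\rho:=\beta_1'\beta_2-\beta_1\beta_2'>0$. Let $\mathcal H=L^2((0,\ell))\oplus\mathbb C$ with inner product $(\varphi,\chi)_{\mathcal H}=\int_0^\ell\overline{\varphi_1}\chi_1\,dz+\rho^{-1}\overline{\varphi_2}\chi_2$, and let $A$ be the operator $$A\varphi=\begin{pmatrix}-\partial_z^2\varphi_1+m^2\varphi_1\\-[\beta_1\varphi_1(\ell)-\beta_2\partial_z\varphi_1(\ell)]\end{pmatrix}$$ whose domain $D(A)$ consists of the $\varphi=(\varphi_1,\varphi_2)\in\mathcal H$ with $\varphi_1,\partial_z\varphi_1$ absolutely continuous on $[0,\ell]$, $\partial_z^2\varphi_1\in L^2((0,\ell))$, $\varphi_1(0)=0$ (Dirichlet condition) and $\varphi_2=\beta_1'\varphi_1(\ell)-\beta_2'\partial_z\varphi_1(\ell)$. Assume $A>0$, i.e. $(\varphi,A\varphi)_{\mathcal H}>0$ for all $0\ne\varphi\in D(A)$. The operator $A$ is self-adjoint and its spectrum consists of simple eigenvalues $\omega_n^2$, $\omega_n>0$,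 $n=1,2,\dots$; let $\Psi_n=(\psi_n,\psi_n^\partial)$ be corresponding normalised eigenfunctions. Let $f\in C_{0,R}(\mathbb R,D(\sqrt A))$, i.e. $f:\mathbb R\to D(\sqrt A)$ is compactly supported, continuous for the graph norm $\|\varphi\|_{\mathcal H}+\|\sqrt A\varphi\|_{\mathcal H}$, and takes values with real-valued components. Let $\phi^{\rm D}_f=\mathsf E_{\rm D}f$, that is, $$\phi_f^{\rm D}(t,z)=-\int_{\mathbb R}dt'\,\sum_{n}\frac{\sin(\omega_n(t-t'))}{\omega_n}\,(\Psi_n,f(t'))_{\mathcal H}\begin{pmatrix}\psi_n(z)\\ \psi_n^\partial\end{pmatrix}.$$ Then the series and the integral converge, in $\mathcal H$ as well as for each $t\in\mathbb R$, $z\in[0,\ell]$, and define the same element of $\mathcal H$ for each $t$; the first component $(\phi_f^{\rm D})_1(t,z)$ is continuously differentiable in $t$ and $z$ on $\mathbb R\times[0,\ell]$ (with one-sided $z$-derivatives at the end points and both partial derivatives jointly continuous), the second component $(\phi_f^{\rm D})_2(t)$ is continuously differentiable in $t$, and all these derivatives are uniformly bounded for $t\in\mathbb R$, $z\in[0,\ell]$.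 -/

import Mathlib

open MeasureTheory Set

noncomputable section

namespace DynBC

/-- The real parameters of the bulk-boundary system: the length `ℓ` of the interval, the mass `m`
and the coefficients of the dynamical boundary condition at `z = ℓ`. -/
structure Params where
  ℓ : ℝ
  m : ℝ
  β₁ : ℝ
  β₂ : ℝ
  β₁' : ℝ
  β₂' : ℝ

/-- The determinant `ρ = β₁' β₂ - β₁ β₂'`. -/
def Params.ρ (p : Params) : ℝ := p.β₁' * p.β₂ - p.β₁ * p.β₂'

/-- The measure `dz` on the bulk `(0, ℓ)` plus a point mass `ρ⁻¹` at the boundary observable. -/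
def bbMeasure (p : Params) : Measure (ℝ ⊕ Unit) :=
  (volume.restrict (Ioo 0 p.ℓ)).map Sum.inl +
    ENNReal.ofReal p.ρ⁻¹ • Measure.dirac (Sum.inr ())

/-- The Hilbert space `L²((0,ℓ)) ⊕ ℂ` with the inner product
`∫₀^ℓ conj φ₁ χ₁ dz + ρ⁻¹ conj φ₂ χ₂`, realised as `L²` of the disjoint union of `(0,ℓ)` and a
point of mass `ρ⁻¹`. -/
abbrev BBSpace (p : Params) : Type := Lp ℂ 2 (bbMeasure p)

/-- The pair `(u, c)` with bulk component `u` and boundary component `c`. -/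
def bb (u : ℝ → ℂ) (c : ℂ) : ℝ ⊕ Unit → ℂ := Sum.elim u (fun _ => c)

/-- `φ = (u, c)` as elements of the Hilbert space. -/
def Represents (p : Params) (φ : BBSpace p) (u : ℝ → ℂ) (c : ℂ) : Prop :=
  φ =ᵐ[bbMeasure p] bb u c

/-- `u` and `u' = v` are absolutely continuous on `[0, ℓ]`, `u'' = w ∈ L²((0, ℓ))`, and `u`
satisfies the Dirichlet condition at `0`. -/
structure IsDirichletH2 (p : Params) (u v w : ℝ → ℂ) : Prop where
  memLp : MemLp w 2 (volume.restrict (Ioo 0 p.ℓ))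
  u_eq : ∀ z ∈ Icc 0 p.ℓ, u z = u 0 + ∫ y in (0 : ℝ)..z, v y
  v_eq : ∀ z ∈ Icc 0 p.ℓ, v z = v 0 + ∫ y in (0 : ℝ)..z, w y
  dirichlet : u 0 = 0

/-- The graph of the operator `A` (with `V = 0` and the Dirichlet condition at `z = 0`):
`IsA p φ χ` means `φ ∈ D(A)` and `A φ = χ`. Here `φ = (u, β₁' u(ℓ) - β₂' u'(ℓ))` and
`χ = (-u'' + m² u, -(β₁ u(ℓ) - β₂ u'(ℓ)))`. -/
def IsA (p : Params) (φ χ : BBSpace p) : Prop :=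
  ∃ u v w : ℝ → ℂ, IsDirichletH2 p u v w ∧
    Represents p φ u (p.β₁' * u p.ℓ - p.β₂' * v p.ℓ) ∧
    Represents p χ (fun z => -w z + (p.m : ℂ) ^ 2 * u z) (-(p.β₁ * u p.ℓ - p.β₂ * v p.ℓ))

/-- `A > 0`. -/
def APositive (p : Params) : Prop :=
  ∀ φ χ : BBSpace p, IsA p φ χ → φ ≠ 0 → 0 < (inner ℂ φ χ).re

/-- `S` is the (unique) non-negative self-adjoint operator with `S² = A`, i.e. `S = √A`. -/
structure IsSqrtOfA (p : Params) (S : BBSpace p →ₗ.[ℂ] BBSpace p) : Prop where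
  selfAdjoint : IsSelfAdjoint S
  nonneg : ∀ φ : S.domain, 0 ≤ (inner ℂ (φ : BBSpace p) (S φ)).re
  sq_eq : ∀ φ χ : BBSpace p, IsA p φ χ ↔ ∃ η, (φ, η) ∈ S.graph ∧ (η, χ) ∈ S.graph

/-- The graph of `√A`: `φ ∈ D(√A)` and `√A φ = χ`. -/
def SqrtA (p : Params) (φ χ : BBSpace p) : Prop :=
  ∃ S : BBSpace p →ₗ.[ℂ] BBSpace p, IsSqrtOfA p S ∧ (φ, χ) ∈ S.graph

/-- The test functions `C_{0,R}(ℝ, D(√A))`: compactly supported, with real-valued components, and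
continuous into `D(√A)` with the graph norm, i.e. both `f` and `√A f` are continuous into the
Hilbert space. -/
def IsTestFunction (p : Params) (f : ℝ → BBSpace p) : Prop :=
  HasCompactSupport f ∧
  (∀ t, ∀ᵐ x ∂(bbMeasure p), (f t x).im = 0) ∧
  ∃ g : ℝ → BBSpace p, (∀ t, SqrtA p (f t) (g t)) ∧ Continuous f ∧ Continuous g

/-- The eigenvalues `λ = ω²` of `A`. -/
def eigenvalues (p : Params) : Set ℝ :=
  {lam | ∃ φ : BBSpace p, φ ≠ 0 ∧ IsA p φ ((lam : ℂ) • φ)}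

/-- The frequency `ω = √λ` of an eigenvalue `λ`. -/
def freq {p : Params} (lam : eigenvalues p) : ℝ := Real.sqrt lam

/-- A normalised eigenfunction `Ψ_λ = (ψ_λ, ψ_λ^∂)` for each eigenvalue `λ` of `A`, with `ψ_λ` its
continuous representative on `[0, ℓ]`. As all eigenvalues are simple, this is the complete
orthonormal system of eigenfunctions, indexed by the eigenvalues instead of by their rank. -/
structure IsEigenSystem (p : Params) (Ψ : eigenvalues p → BBSpace p)
    (ψ : eigenvalues p → ℝ → ℂ) (ψb : eigenvalues p → ℂ) : Prop where
  eigen : ∀ lam, IsA p (Ψ lam) (((lam : ℝ) : ℂ) • Ψ lam)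
  norm_one : ∀ lam, ‖Ψ lam‖ = 1
  continuousOn : ∀ lam, ContinuousOn (ψ lam) (Icc 0 p.ℓ)
  represents : ∀ lam, Represents p (Ψ lam) (ψ lam) (ψb lam)

variable {p : Params}

/-- The `λ`-th coefficient `ω⁻¹ sin(ω (t - t')) (Ψ_λ, f(t'))`. -/
def modeCoeff (Ψ : eigenvalues p → BBSpace p) (f : ℝ → BBSpace p) (t t' : ℝ)
    (lam : eigenvalues p) : ℂ :=
  ((1 / freq lam * Real.sin (freq lam * (t - t')) : ℝ) : ℂ) * inner ℂ (Ψ lam) (f t')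

/-- `E(t - t') f(t')`, where `E(τ) = -∑ ω⁻¹ sin(ω τ) |Ψ_λ⟩⟨Ψ_λ|`. -/
def kernelApply (Ψ : eigenvalues p → BBSpace p) (f : ℝ → BBSpace p) (t t' : ℝ) : BBSpace p :=
  -∑' lam, modeCoeff Ψ f t t' lam • Ψ lam

/-- The solution `φ_f = E_D f` as a function of `t` with values in the Hilbert space:
`φ_f(t) = ∫ E(t - t') f(t') dt'`. -/
def solution (Ψ : eigenvalues p → BBSpace p) (f : ℝ → BBSpace p) (t : ℝ) : BBSpace p :=
  ∫ t', kernelApply Ψ f t t'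

/-- The bulk component of `φ_f` at the point `(t, z)`. -/
def bulkField (Ψ : eigenvalues p → BBSpace p) (ψ : eigenvalues p → ℝ → ℂ)
    (f : ℝ → BBSpace p) (t z : ℝ) : ℂ :=
  -∫ t', ∑' lam, modeCoeff Ψ f t t' lam * ψ lam z

/-- The boundary component of `φ_f` at time `t`. -/
def boundaryField (Ψ : eigenvalues p → BBSpace p) (ψb : eigenvalues p → ℂ)
    (f : ℝ → BBSpace p) (t : ℝ) : ℂ :=
  -∫ t', ∑' lam, modeCoeff Ψ f t t' lam * ψb lam

/-- The series and integrals defining `φ_f`, in the Hilbert space and pointwise, all converge. -/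
structure FieldConverges (Ψ : eigenvalues p → BBSpace p) (ψ : eigenvalues p → ℝ → ℂ)
    (ψb : eigenvalues p → ℂ) (f : ℝ → BBSpace p) : Prop where
  summable : ∀ t t', Summable fun lam => modeCoeff Ψ f t t' lam • Ψ lam
  integrable : ∀ t, Integrable (kernelApply Ψ f t)
  bulk_summable : ∀ t t', ∀ z ∈ Icc 0 p.ℓ, Summable fun lam => modeCoeff Ψ f t t' lam * ψ lam z
  bulk_integrable : ∀ t, ∀ z ∈ Icc 0 p.ℓ,
    Integrable fun t' => ∑' lam, modeCoeff Ψ f t t' lam * ψ lam z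
  boundary_summable : ∀ t t', Summable fun lam => modeCoeff Ψ f t t' lam * ψb lam
  boundary_integrable : ∀ t, Integrable fun t' => ∑' lam, modeCoeff Ψ f t t' lam * ψb lam

end DynBC

end

/-! Everything reduces to one absolutely convergent majorant for the mode expansion, obtained
without eigenvalue asymptotics. For an eigenfunction with classical representative `U` and `V = U'`,
put `b = ‖V 0‖ / (1 + lam)`. A Gronwall energy estimate started at the Dirichlet end
(`IsMode.energy_le`) controls the whole mode by `V 0`: up to constants independent of the mode,
`|U'| ≤ ω² b`, while `|U|` and the boundary value are at most `ω b`. The family `b` is square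
summable. Integrating by parts twice against a weight vanishing to second order at `z = ℓ`
(`IsMode.deriv_zero_eq`) writes `V 0` as `(1 + lam)⟨k₁, Ψ⟩ + ⟨k₂, Ψ⟩` with fixed `k₁`, `k₂`, so
Bessel's inequality applies (`exists_square_summable_bound`). With `g = √A f` one has `⟨Ψ, g⟩ = ω
⟨Ψ, f⟩`, so Cauchy-Schwarz and Bessel give `∑ |⟨Ψ, f⟩| ω b ≤ ‖g‖ (∑ b²)^(1/2)`, which is integrable
in time (`IsModeSource.sum_le`, `IsModeSource.summable_modeMass`). A time derivative turns `sin / ω`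
into `cos` and meets `|U| ≤ ω b`; a space derivative keeps `1 / ω` and meets `|U'| ≤ ω² b`. Both
series thus have the same majorant, so they may be differentiated termwise with continuous,
uniformly bounded sums. Bessel's inequality suffices throughout; completeness of the eigenfunctions
plays no role. -/

/-! ### The bulk-boundary measure -/

theorem measurableEmbedding_sumInl {α β : Type*} [MeasurableSpace α] [MeasurableSpace β] :
    MeasurableEmbedding (Sum.inl : α → α ⊕ β) :=
  ⟨Sum.inl_injective, measurable_inl, fun _ hs => MeasurableSet.inl_image hs⟩

instance {α β : Type*} [MeasurableSpace α] [MeasurableSpace β] [MeasurableSingletonClass α]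
    [MeasurableSingletonClass β] : MeasurableSingletonClass (α ⊕ β) where
  measurableSet_singleton
    | Sum.inl a => by
      simpa using MeasurableSet.inl_image (β := β) (measurableSet_singleton a)
    | Sum.inr b => by
      simpa using MeasurableSet.inr_image (α := α) (measurableSet_singleton b)

namespace DynBC

variable {p : Params}

instance : IsFiniteMeasure (bbMeasure p) := by
  unfold bbMeasure
  have : IsFiniteMeasure ((volume.restrict (Ioo 0 p.ℓ)).map (Sum.inl : ℝ → ℝ ⊕ Unit)) :=
    Measure.isFiniteMeasure_map _ _
  have : IsFiniteMeasure (ENNReal.ofReal p.ρ⁻¹ • Measure.dirac (Sum.inr () : ℝ ⊕ Unit)) :=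
    Measure.smul_finite _ ENNReal.ofReal_ne_top
  infer_instance

theorem ae_bbMeasure_iff (hρ : 0 < p.ρ) {P : ℝ ⊕ Unit → Prop} :
    (∀ᵐ x ∂bbMeasure p, P x) ↔
      (∀ᵐ z ∂volume.restrict (Ioo 0 p.ℓ), P (Sum.inl z)) ∧ P (Sum.inr ()) := by
  have h0 : ENNReal.ofReal p.ρ⁻¹ ≠ 0 := by simpa using hρ
  rw [bbMeasure, ae_add_measure_iff, measurableEmbedding_sumInl.ae_map_iff,
    Measure.ae_ennreal_smul_measure_iff h0, ae_dirac_eq]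
  simp

theorem integral_bbMeasure {F : ℝ ⊕ Unit → ℂ} (hρ : 0 < p.ρ) (hF : Integrable F (bbMeasure p)) :
    ∫ x, F x ∂bbMeasure p =
      (∫ z in Ioo 0 p.ℓ, F (Sum.inl z)) + p.ρ⁻¹ • F (Sum.inr ()) := by
  rw [bbMeasure] at hF ⊢
  rw [integral_add_measure hF.left_of_add_measure hF.right_of_add_measure,
    measurableEmbedding_sumInl.integral_map, integral_smul_measure, integral_dirac,
    ENNReal.toReal_ofReal (inv_pos.2 hρ).le]

/-! ### Eigenfunctions as classical solutions, and their energy -/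

/-- The classical form of an eigenfunction of `A`: `U'' = (m² - lam) U` on `[0, ℓ]`, together with
both boundary conditions. -/
structure IsMode (p : Params) (lam : ℝ) (U V : ℝ → ℂ) (c : ℂ) : Prop where
  hasDerivAt_U : ∀ z, HasDerivAt U (V z) z
  hasDerivAt_V : ∀ z ∈ Icc 0 p.ℓ, HasDerivAt V ((p.m ^ 2 - lam) • U z) z
  dirichlet : U 0 = 0
  boundary : c = p.β₁' * U p.ℓ - p.β₂' * V p.ℓ
  dynamic : (lam : ℂ) * c = -(p.β₁ * U p.ℓ - p.β₂ * V p.ℓ)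

/-- Elliptic regularity in one dimension: the eigenvalue equation says that `w` is a.e. a multiple
of the continuous function `u₁`, so integrating that multiple instead of `w` yields a twice
differentiable solution. -/
theorem exists_isMode (hl : 0 < p.ℓ) (hρ : 0 < p.ρ) {lam : ℝ} {Φ : BBSpace p} {u : ℝ → ℂ} {c : ℂ}
    (hA : IsA p Φ ((lam : ℂ) • Φ)) (hu : ContinuousOn u (Icc 0 p.ℓ))
    (hΦ : Represents p Φ u c) :
    ∃ U V : ℝ → ℂ, IsMode p lam U V c ∧ EqOn U u (Icc 0 p.ℓ) := by
  obtain ⟨u₁, v, w, hH, h1, h2⟩ := hA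
  have hl' : (0 : ℝ) ≤ p.ℓ := hl.le
  have hw : IntervalIntegrable w volume 0 p.ℓ := by
    rw [intervalIntegrable_iff_integrableOn_Ioo_of_le hl']
    exact hH.memLp.integrable (by norm_num)
  have hvc : ContinuousOn v (Icc 0 p.ℓ) := by
    have h := intervalIntegral.continuousOn_primitive_interval' hw
      (left_mem_uIcc : (0 : ℝ) ∈ uIcc 0 p.ℓ)
    rw [uIcc_of_le hl'] at h
    exact (continuousOn_const.add h).congr hH.v_eq
  have huc : ContinuousOn u₁ (Icc 0 p.ℓ) := by
    have hv : IntervalIntegrable v volume 0 p.ℓ :=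
      ContinuousOn.intervalIntegrable (by rwa [uIcc_of_le hl'])
    have h := intervalIntegral.continuousOn_primitive_interval' hv
      (left_mem_uIcc : (0 : ℝ) ∈ uIcc 0 p.ℓ)
    rw [uIcc_of_le hl'] at h
    exact (continuousOn_const.add h).congr hH.u_eq
  have e1 : bb u₁ (p.β₁' * u₁ p.ℓ - p.β₂' * v p.ℓ) =ᵐ[bbMeasure p] bb u c := h1.symm.trans hΦ
  have e2 : (fun x => (lam : ℂ) * bb u₁ (p.β₁' * u₁ p.ℓ - p.β₂' * v p.ℓ) x) =ᵐ[bbMeasure p]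
      bb (fun z => -w z + (p.m : ℂ) ^ 2 * u₁ z) (-(p.β₁ * u₁ p.ℓ - p.β₂ * v p.ℓ)) := by
    filter_upwards [h1, h2, Lp.coeFn_smul (lam : ℂ) Φ] with x hx1 hx2 hx3
    rw [← hx2, hx3, ← hx1]; rfl
  obtain ⟨e1u, e1c⟩ := (ae_bbMeasure_iff hρ).1 e1
  obtain ⟨e2u, e2c⟩ := (ae_bbMeasure_iff hρ).1 e2
  simp only [bb, Sum.elim_inl, Sum.elim_inr] at e1u e1c e2u e2c
  have hEq : EqOn u₁ u (Icc 0 p.ℓ) := by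
    refine Measure.eqOn_Icc_of_ae_eq (μ := volume) hl.ne ?_ huc hu
    rw [← restrict_Ioo_eq_restrict_Icc]; exact e1u
  set cc : ℝ := p.m ^ 2 - lam
  -- Extending `u₁` by constants outside the interval gives two-sided derivatives at the end points
  -- as well.
  set ut : ℝ → ℂ := IccExtend hl' (domRestrict (Icc 0 p.ℓ) u₁)
  have hut : Continuous ut := (continuousOn_iff_continuous_domRestrict.1 huc).Icc_extend'
  have hut' : ∀ z ∈ Icc 0 p.ℓ, ut z = u₁ z := fun z hz => IccExtend_of_mem hl' _ hz
  set V : ℝ → ℂ := fun z => v 0 + ∫ y in (0 : ℝ)..z, cc • ut y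
  have hV : ∀ z, HasDerivAt V (cc • ut z) z := fun z =>
    ((hut.const_smul cc).integral_hasStrictDerivAt 0 z).hasDerivAt.const_add _
  have hVc : Continuous V := continuous_iff_continuousAt.2 fun z => (hV z).continuousAt
  have hVv : ∀ z ∈ Icc 0 p.ℓ, V z = v z := by
    intro z hz
    rw [hH.v_eq z hz]
    simp only [V]
    congr 1
    refine intervalIntegral.integral_congr_ae_restrict ?_
    rw [uIoc_of_le hz.1]
    have : Ioc 0 z ⊆ Icc 0 p.ℓ := fun y hy => ⟨hy.1.le, hy.2.trans hz.2⟩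
    have e := ae_restrict_of_ae_restrict_of_subset this
      (restrict_Ioo_eq_restrict_Icc (μ := (volume : Measure ℝ)) ▸ e2u)
    filter_upwards [e, ae_restrict_mem measurableSet_Ioc] with y hy hym
    rw [hut' y (this hym), Complex.real_smul]
    simp only [cc]; push_cast
    linear_combination -hy
  refine ⟨fun z => ∫ y in (0 : ℝ)..z, V y, V, ?_, ?_⟩
  all_goals
    have hU : ∀ z ∈ Icc 0 p.ℓ, ∫ y in (0 : ℝ)..z, V y = u₁ z := by
      intro z hz
      rw [hH.u_eq z hz, hH.dirichlet, zero_add]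
      refine intervalIntegral.integral_congr fun y hy => hVv y ?_
      rw [uIcc_of_le hz.1] at hy
      exact ⟨hy.1, hy.2.trans hz.2⟩
  · have hlm : p.ℓ ∈ Icc 0 p.ℓ := right_mem_Icc.2 hl'
    refine ⟨fun z => (hVc.integral_hasStrictDerivAt 0 z).hasDerivAt, fun z hz => ?_, by simp, ?_, ?_⟩
    · rw [hU z hz, ← hut' z hz]; exact hV z
    · simp only [hU _ hlm, hVv _ hlm]; exact e1c.symm
    · simp only [hU _ hlm, hVv _ hlm]; rw [← e1c]; exact e2c
  · intro z hz
    simp only [hU z hz]; exact hEq hz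

namespace IsMode

variable {lam : ℝ} {U V : ℝ → ℂ} {c : ℂ}

theorem continuous_U (h : IsMode p lam U V c) : Continuous U :=
  continuous_iff_continuousAt.2 fun z => (h.hasDerivAt_U z).continuousAt

theorem continuousOn_V (h : IsMode p lam U V c) : ContinuousOn V (Icc 0 p.ℓ) :=
  fun z hz => (h.hasDerivAt_V z hz).continuousAt.continuousWithinAt

/-- The energy estimate. -/
theorem energy_le (h : IsMode p lam U V c) (hlam : 0 ≤ lam) {z : ℝ} (hz : z ∈ Icc 0 p.ℓ) :
    ‖V z‖ ^ 2 + (1 + lam) * ‖U z‖ ^ 2 ≤ Real.exp ((p.m ^ 2 + 1) * p.ℓ) * ‖V 0‖ ^ 2 := by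
  set F : ℝ → ℝ := fun z => ‖V z‖ ^ 2 + (1 + lam) * ‖U z‖ ^ 2
  have hF : ∀ z ∈ Icc 0 p.ℓ, HasDerivAt F (2 * (p.m ^ 2 + 1) * inner ℝ (U z) (V z)) z := by
    intro z hz
    have h1 := (h.hasDerivAt_V z hz).norm_sq
    have h2 := ((h.hasDerivAt_U z).norm_sq).const_mul (1 + lam)
    -- The weight `1 + lam` makes `lam` cancel in `2(m² - lam) + 2(1 + lam)`, so the growth rate is
    -- uniform in the mode.
    convert! h1.add h2 using 1
    rw [inner_smul_right, real_inner_comm]; ring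
  have hF0 : ∀ z, 0 ≤ F z := fun z => by positivity
  have key := norm_le_gronwallBound_of_norm_deriv_right_le (f := F) (δ := ‖V 0‖ ^ 2)
    (K := p.m ^ 2 + 1) (ε := 0) (a := 0) (b := p.ℓ)
    (fun z hz => (hF z hz).continuousAt.continuousWithinAt)
    (fun z hz => (hF z ⟨hz.1, hz.2.le⟩).hasDerivWithinAt)
    (by simp [F, h.dirichlet]) (fun z _ => ?_) z hz
  · rw [gronwallBound_ε0, sub_zero, Real.norm_of_nonneg (hF0 z), mul_comm] at key
    refine key.trans ?_
    gcongr
    exact hz.2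
  · rw [Real.norm_of_nonneg (hF0 z), norm_mul, Real.norm_of_nonneg (by positivity), add_zero]
    have h1 := norm_inner_le_norm (𝕜 := ℝ) (U z) (V z)
    have h2 : 2 * (‖U z‖ * ‖V z‖) ≤ F z := by
      have : 0 ≤ lam * ‖U z‖ ^ 2 := by positivity
      simp only [F]
      nlinarith [sq_nonneg (‖U z‖ - ‖V z‖)]
    calc 2 * (p.m ^ 2 + 1) * ‖inner ℝ (U z) (V z)‖
        ≤ 2 * (p.m ^ 2 + 1) * (‖U z‖ * ‖V z‖) := by gcongr
      _ = (p.m ^ 2 + 1) * (2 * (‖U z‖ * ‖V z‖)) := by ring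
      _ ≤ _ := by gcongr

/-- The quadratic test function `(1 - z/ℓ)²` recovers `U'(0)`. -/
theorem deriv_zero_eq (h : IsMode p lam U V c) (hl : 0 < p.ℓ) :
    V 0 = ∫ z in (0 : ℝ)..p.ℓ,
      (((lam - p.m ^ 2) * (1 - z / p.ℓ) ^ 2 + 2 / p.ℓ ^ 2 : ℝ) : ℂ) * U z := by
  -- The primitive is `-q V + q' U` with `q = (1 - z/ℓ)²`; since `q` and `q'` vanish at `ℓ` and `U 0
  -- = 0`, only `V 0` survives.
  have hd : ∀ z ∈ uIcc 0 p.ℓ, HasDerivAt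
      (fun z => -((((1 - z / p.ℓ) ^ 2 : ℝ) : ℂ) * V z) - ((2 / p.ℓ * (1 - z / p.ℓ) : ℝ) : ℂ) * U z)
      ((((lam - p.m ^ 2) * (1 - z / p.ℓ) ^ 2 + 2 / p.ℓ ^ 2 : ℝ) : ℂ) * U z) z := by
    intro z hz
    rw [uIcc_of_le hl.le] at hz
    have h0 : HasDerivAt (fun z : ℝ => 1 - z / p.ℓ) (-(1 / p.ℓ)) z := by
      simpa using ((hasDerivAt_id z).div_const p.ℓ).const_sub 1
    have h1 := (h0.pow 2).ofReal_comp
    have h2 := (h0.const_mul (2 / p.ℓ)).ofReal_comp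
    convert! ((h1.mul (h.hasDerivAt_V z hz)).neg).sub (h2.mul (h.hasDerivAt_U z)) using 1
    have : (p.ℓ : ℂ) ≠ 0 := by exact_mod_cast hl.ne'
    simp only [Complex.real_smul, Pi.pow_apply]
    push_cast
    field_simp
    ring
  rw [intervalIntegral.integral_eq_sub_of_hasDerivAt hd]
  · simp [h.dirichlet, hl.ne']
  · refine (Continuous.mul ?_ h.continuous_U).intervalIntegrable _ _
    fun_prop

end IsMode

/-! ### The square root of `A` on eigenvectors -/

section SquareRoot

variable {S : BBSpace p →ₗ.[ℂ] BBSpace p}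

theorem IsSqrtOfA.inner_eq (hS : IsSqrtOfA p S) {x x' y y' : BBSpace p}
    (hx : (x, x') ∈ S.graph) (hy : (y, y') ∈ S.graph) : inner ℂ x' y = inner ℂ x y' := by
  obtain ⟨a, rfl, rfl⟩ := S.mem_graph_iff.1 hx
  obtain ⟨b, rfl, rfl⟩ := S.mem_graph_iff.1 hy
  have h := S.adjoint_isFormalAdjoint hS.selfAdjoint.dense_domain
  rw [LinearPMap.isSelfAdjoint_def.1 hS.selfAdjoint] at h
  exact h a b

/-- If `η = S Φ`, then `S` maps `η - ω Φ` to `-ω (η - ω Φ)`; a nonnegative `S` has no negative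
eigenvalue, so `η = ω Φ`. -/
theorem IsSqrtOfA.eigenvector_mem_graph (hS : IsSqrtOfA p S) {lam : ℝ} (hlam : 0 < lam)
    {Φ : BBSpace p} (hΦ : IsA p Φ ((lam : ℂ) • Φ)) :
    (Φ, ((Real.sqrt lam : ℝ) : ℂ) • Φ) ∈ S.graph := by
  obtain ⟨η, h1, h2⟩ := (hS.sq_eq _ _).1 hΦ
  set ω := Real.sqrt lam
  have hω : 0 < ω := Real.sqrt_pos.2 hlam
  have hlω : (lam : ℂ) = (ω : ℂ) * ω := by
    rw [← Complex.ofReal_mul, Real.mul_self_sqrt hlam.le]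
  have h3 : (η - (ω : ℂ) • Φ, -(ω : ℂ) • (η - (ω : ℂ) • Φ)) ∈ S.graph := by
    have h := S.graph.sub_mem h2 (S.graph.smul_mem (ω : ℂ) h1)
    convert h using 1
    ext1
    · rfl
    · simp only [Prod.smul_mk, Prod.mk_sub_mk, hlω]; module
  obtain ⟨a, ha, ha'⟩ := S.mem_graph_iff.1 h3
  have h4 := hS.nonneg a
  simp only at ha ha'
  rw [ha', ha, inner_smul_right, inner_self_eq_norm_sq_to_K] at h4
  have h5 : ‖η - (ω : ℂ) • Φ‖ = 0 := by
    have : (-(ω : ℂ) * ((‖η - (ω : ℂ) • Φ‖ : ℝ) : ℂ) ^ 2).re =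
        -(ω * ‖η - (ω : ℂ) • Φ‖ ^ 2) := by
      rw [← Complex.ofReal_pow, ← Complex.ofReal_neg, ← Complex.ofReal_mul, Complex.ofReal_re]
      ring
    have h4' : 0 ≤ -(ω * ‖η - (ω : ℂ) • Φ‖ ^ 2) := this ▸ h4
    by_contra hne
    have : 0 < ω * ‖η - (ω : ℂ) • Φ‖ ^ 2 := by positivity
    linarith
  rw [norm_eq_zero, sub_eq_zero] at h5
  rwa [h5] at h1

end SquareRoot

/-! ### Orthonormality of the eigenfunctions -/

section EigenSystem

variable {Ψ : eigenvalues p → BBSpace p} {ψ : eigenvalues p → ℝ → ℂ} {ψb : eigenvalues p → ℂ}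

theorem IsEigenSystem.pos (hΨ : IsEigenSystem p Ψ ψ ψb) (hA : APositive p) (lam : eigenvalues p) :
    0 < (lam : ℝ) := by
  have hne : Ψ lam ≠ 0 := fun h => by simpa [h] using hΨ.norm_one lam
  have h := hA _ _ (hΨ.eigen lam) hne
  rw [inner_smul_right, inner_self_eq_norm_sq_to_K, hΨ.norm_one] at h
  simpa using h

theorem IsEigenSystem.freq_pos (hΨ : IsEigenSystem p Ψ ψ ψb) (hA : APositive p)
    (lam : eigenvalues p) : 0 < freq lam := Real.sqrt_pos.2 (hΨ.pos hA lam)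

theorem IsEigenSystem.freq_sq (hΨ : IsEigenSystem p Ψ ψ ψb) (hA : APositive p)
    (lam : eigenvalues p) : freq lam ^ 2 = lam := Real.sq_sqrt (hΨ.pos hA lam).le

theorem IsEigenSystem.inner_sqrt (hΨ : IsEigenSystem p Ψ ψ ψb) (hA : APositive p)
    {φ χ : BBSpace p} (h : SqrtA p φ χ) (lam : eigenvalues p) :
    inner ℂ (Ψ lam) χ = freq lam * inner ℂ (Ψ lam) φ := by
  obtain ⟨S, hS, hφ⟩ := h
  rw [← hS.inner_eq (hS.eigenvector_mem_graph (hΨ.pos hA lam) (hΨ.eigen lam)) hφ, inner_smul_left,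
    Complex.conj_ofReal]
  rfl

/-- The index is the eigenvalue itself, so different indices have different frequencies and symmetry
of `√A` forces orthogonality. The pair `φ`, `χ` only serves to supply a square root. -/
theorem IsEigenSystem.orthonormal (hΨ : IsEigenSystem p Ψ ψ ψb) (hA : APositive p)
    {φ χ : BBSpace p} (h : SqrtA p φ χ) : Orthonormal ℂ Ψ := by
  obtain ⟨S, hS, -⟩ := h
  refine ⟨hΨ.norm_one, fun lam mu hne => ?_⟩
  have h1 := hΨ.inner_sqrt hA
    ⟨S, hS, hS.eigenvector_mem_graph (hΨ.pos hA mu) (hΨ.eigen mu)⟩ lam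
  rw [inner_smul_right] at h1
  have h2 : ((freq mu - freq lam : ℝ) : ℂ) * inner ℂ (Ψ lam) (Ψ mu) = 0 := by
    push_cast; rw [sub_mul, sub_eq_zero]; exact h1
  refine (mul_eq_zero.1 h2).resolve_left fun h3 => hne ?_
  have h4 : freq mu = freq lam := sub_eq_zero.1 (by exact_mod_cast h3)
  apply Subtype.ext
  rw [← hΨ.freq_sq hA lam, ← hΨ.freq_sq hA mu, h4]

end EigenSystem

/-! ### Square summable bounds on the modes -/

/-- Integration against a continuous real function is an inner product in the Hilbert space. -/
theorem exists_inner_eq_integral (hl : 0 < p.ℓ) (hρ : 0 < p.ρ) {q : ℝ → ℝ} (hq : Continuous q) :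
    ∃ k : BBSpace p, ∀ (Φ : BBSpace p) (u : ℝ → ℂ) (c : ℂ), Represents p Φ u c →
      inner ℂ k Φ = ∫ z in (0 : ℝ)..p.ℓ, (q z : ℂ) * u z := by
  have hqc : Continuous fun z => (q z : ℂ) := Complex.continuous_ofReal.comp hq
  have hmeas : Measurable (bb (fun z => (q z : ℂ)) 0) :=
    measurable_fun_sum hqc.measurable measurable_const
  obtain ⟨C, hC⟩ := isCompact_Icc.exists_bound_of_continuousOn (s := Icc 0 p.ℓ) hq.continuousOn
  have hmem : MemLp (bb (fun z => (q z : ℂ)) 0) 2 (bbMeasure p) := by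
    refine MemLp.of_bound hmeas.aestronglyMeasurable (max C 0) ((ae_bbMeasure_iff hρ).2 ⟨?_, ?_⟩)
    · filter_upwards [ae_restrict_mem measurableSet_Ioo] with z hz
      simpa [bb] using (hC z (Ioo_subset_Icc_self hz)).trans (le_max_left C 0)
    · simp [bb]
  refine ⟨hmem.toLp _, fun Φ u c hΦ => ?_⟩
  have hae : (fun x => inner ℂ (hmem.toLp _ x) (Φ x)) =ᵐ[bbMeasure p]
      fun x => inner ℂ (bb (fun z => (q z : ℂ)) 0 x) (bb u c x) := by
    filter_upwards [hmem.coeFn_toLp, hΦ] with x h1 h2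
    rw [h1, h2]
  rw [L2.inner_def, integral_congr_ae hae,
    integral_bbMeasure hρ ((L2.integrable_inner _ _).congr hae),
    intervalIntegral.integral_of_le hl.le, integral_Ioc_eq_integral_Ioo]
  simp [bb, mul_comm]

theorem norm_le_of_represents (hρ : 0 < p.ρ) {Φ : BBSpace p} {u : ℝ → ℂ} {c : ℂ}
    (hΦ : Represents p Φ u c) {C : ℝ} (hu : ∀ z ∈ Icc 0 p.ℓ, ‖u z‖ ≤ C) (hc : ‖c‖ ≤ C) :
    ‖Φ‖ ≤ (measureUnivNNReal (bbMeasure p) : ℝ) ^ (2 : ENNReal).toReal⁻¹ * C := by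
  refine Lp.norm_le_of_ae_bound ((norm_nonneg c).trans hc) ?_
  have : ∀ᵐ x ∂bbMeasure p, ‖bb u c x‖ ≤ C := by
    refine (ae_bbMeasure_iff hρ).2 ⟨?_, hc⟩
    filter_upwards [ae_restrict_mem measurableSet_Ioo] with z hz
    exact hu z (Ioo_subset_Icc_self hz)
  filter_upwards [hΦ, this] with x h1 h2
  rwa [h1]

/-- Uniform pointwise bounds on the eigenfunctions, in terms of a square summable family `b`. -/
structure ModeBounds (p : Params) (ψ : eigenvalues p → ℝ → ℂ) (ψb : eigenvalues p → ℂ)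
    (V : eigenvalues p → ℝ → ℂ) (b : eigenvalues p → ℝ) (K : ℝ) : Prop where
  K_nonneg : 0 ≤ K
  b_nonneg : ∀ lam, 0 ≤ b lam
  summable : Summable fun lam => b lam ^ 2
  one_le : ∀ lam, 1 ≤ K * (freq lam ^ 2 * b lam)
  bulk_le : ∀ lam, ∀ z ∈ Icc 0 p.ℓ, ‖ψ lam z‖ ≤ K * (freq lam * b lam)
  bulk_le' : ∀ lam, ∀ z ∈ Icc 0 p.ℓ, ‖ψ lam z‖ ≤ K * (freq lam ^ 2 * b lam)
  boundary_le : ∀ lam, ‖ψb lam‖ ≤ K * (freq lam * b lam)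
  boundary_le' : ∀ lam, ‖ψb lam‖ ≤ K * (freq lam ^ 2 * b lam)
  deriv_le : ∀ lam z, ‖V lam z‖ ≤ K * (freq lam ^ 2 * b lam)
  continuous_deriv : ∀ lam, Continuous (V lam)
  primitive : ∀ lam, ∀ z ∈ Icc 0 p.ℓ, ψ lam z = ∫ y in (0 : ℝ)..z, V lam y

/-- Splitting `lam - m² = (1 + lam) - (m² + 1)` in `IsMode.deriv_zero_eq` bounds `‖V 0‖ / (1 + lam)`
by two Fourier coefficients of fixed vectors. -/
theorem exists_square_summable_bound (hl : 0 < p.ℓ) (hρ : 0 < p.ρ)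
    {Ψ : eigenvalues p → BBSpace p} {U V : eigenvalues p → ℝ → ℂ} {ψb : eigenvalues p → ℂ}
    (hon : Orthonormal ℂ Ψ) (hpos : ∀ lam : eigenvalues p, 0 < (lam : ℝ))
    (hM : ∀ lam : eigenvalues p, IsMode p lam (U lam) (V lam) (ψb lam))
    (hrep : ∀ lam, Represents p (Ψ lam) (U lam) (ψb lam)) :
    Summable fun lam : eigenvalues p => (‖V lam 0‖ / (1 + lam)) ^ 2 := by
  obtain ⟨k₁, hk₁⟩ := exists_inner_eq_integral hl hρ
    (q := fun z => (1 - z / p.ℓ) ^ 2) (by fun_prop)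
  obtain ⟨k₂, hk₂⟩ := exists_inner_eq_integral hl hρ
    (q := fun z => 2 / p.ℓ ^ 2 - (p.m ^ 2 + 1) * (1 - z / p.ℓ) ^ 2) (by fun_prop)
  have hs := ((hon.inner_products_summable (x := k₁)).add
    (hon.inner_products_summable (x := k₂))).mul_left 2
  refine Summable.of_nonneg_of_le (fun _ => sq_nonneg _) (fun lam => ?_) hs
  have hpos1 : 0 < 1 + (lam : ℝ) := by linarith [hpos lam]
  have hV : V lam 0 = ((1 + lam : ℝ) : ℂ) * inner ℂ k₁ (Ψ lam) + inner ℂ k₂ (Ψ lam) := by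
    have hc := (hM lam).continuous_U
    rw [hk₁ _ _ _ (hrep lam), hk₂ _ _ _ (hrep lam), (hM lam).deriv_zero_eq hl,
      ← intervalIntegral.integral_const_mul, ← intervalIntegral.integral_add]
    · congr 1; ext z; push_cast; ring
    · exact (Continuous.mul continuous_const (Continuous.mul (by fun_prop) hc)).intervalIntegrable
        _ _
    · exact (Continuous.mul (by fun_prop) hc).intervalIntegrable _ _
  have h1 : ‖V lam 0‖ / (1 + lam) ≤ ‖inner ℂ (Ψ lam) k₁‖ + ‖inner ℂ (Ψ lam) k₂‖ := by
    rw [div_le_iff₀ hpos1, hV]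
    refine (norm_add_le _ _).trans ?_
    rw [norm_mul, Complex.norm_real, Real.norm_of_nonneg hpos1.le, norm_inner_symm k₁,
      norm_inner_symm k₂]
    nlinarith [norm_nonneg (inner ℂ (Ψ lam) k₂), hpos lam,
      mul_nonneg (hpos lam).le (norm_nonneg (inner ℂ (Ψ lam) k₂))]
  calc (‖V lam 0‖ / (1 + lam)) ^ 2 ≤ (‖inner ℂ (Ψ lam) k₁‖ + ‖inner ℂ (Ψ lam) k₂‖) ^ 2 := by
        gcongr
    _ ≤ _ := add_sq_le

/-- The constants do not depend on the mode. The boundary value gains a full factor `1 + lam`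
because both `c` and `lam * c` are fixed combinations of `U ℓ` and `V ℓ`. -/
theorem IsMode.exists_bound (hl : 0 < p.ℓ) (hρ : 0 < p.ρ) :
    ∃ C M : ℝ, 0 ≤ C ∧ 0 ≤ M ∧ ∀ {lam : ℝ} {U V : ℝ → ℂ} {c : ℂ}, 0 < lam → IsMode p lam U V c →
      (∀ z ∈ Icc 0 p.ℓ, ‖V z‖ ≤ C * ‖V 0‖) ∧
      (∀ z ∈ Icc 0 p.ℓ, Real.sqrt (1 + lam) * ‖U z‖ ≤ C * ‖V 0‖) ∧
      (1 + lam) * ‖c‖ ≤ C * ‖V 0‖ ∧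
      ∀ Φ : BBSpace p, Represents p Φ U c → ‖Φ‖ ≤ M * (C * ‖V 0‖) := by
  set C₀ : ℝ := Real.exp ((p.m ^ 2 + 1) * p.ℓ / 2)
  have hC₀ : 0 < C₀ := Real.exp_pos _
  have hC₀sq : Real.exp ((p.m ^ 2 + 1) * p.ℓ) = C₀ ^ 2 := by
    rw [← Real.exp_nat_mul]; congr 1; push_cast; ring
  set B : ℝ := |p.β₁| + |p.β₂| + |p.β₁'| + |p.β₂'|
  have hB : 0 ≤ B := by positivity
  refine ⟨(1 + B) * C₀, (measureUnivNNReal (bbMeasure p) : ℝ) ^ (2 : ENNReal).toReal⁻¹,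
    by positivity, by positivity, fun {lam U V c} hlam h => ?_⟩
  have hV : ∀ z ∈ Icc 0 p.ℓ, ‖V z‖ ≤ C₀ * ‖V 0‖ := fun z hz => by
    have h1 := h.energy_le hlam.le hz
    rw [hC₀sq, ← mul_pow] at h1
    refine (pow_le_pow_iff_left₀ (by positivity) (by positivity) two_ne_zero).1 (le_trans ?_ h1)
    exact le_add_of_nonneg_right (by positivity)
  have hU : ∀ z ∈ Icc 0 p.ℓ, Real.sqrt (1 + lam) * ‖U z‖ ≤ C₀ * ‖V 0‖ := fun z hz => by
    have h1 := h.energy_le hlam.le hz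
    rw [hC₀sq, ← mul_pow] at h1
    refine (pow_le_pow_iff_left₀ (by positivity) (by positivity) two_ne_zero).1 (le_trans ?_ h1)
    rw [mul_pow, Real.sq_sqrt (by positivity)]
    exact le_add_of_nonneg_left (by positivity)
  have hs : 1 ≤ Real.sqrt (1 + lam) := Real.one_le_sqrt.2 (by linarith)
  have hU' : ∀ z ∈ Icc 0 p.ℓ, ‖U z‖ ≤ C₀ * ‖V 0‖ := fun z hz =>
    (le_mul_of_one_le_left (norm_nonneg _) hs).trans (hU z hz)
  have hle : C₀ * ‖V 0‖ ≤ (1 + B) * C₀ * ‖V 0‖ := by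
    rw [mul_assoc]
    exact le_mul_of_one_le_left (by positivity) (by linarith)
  have hlm : p.ℓ ∈ Icc 0 p.ℓ := right_mem_Icc.2 hl.le
  have hcomb : ∀ x y : ℝ, ‖(x : ℂ) * U p.ℓ - y * V p.ℓ‖ ≤ (|x| + |y|) * (C₀ * ‖V 0‖) := by
    intro x y
    refine (norm_sub_le _ _).trans ?_
    rw [norm_mul, norm_mul, Complex.norm_real, Complex.norm_real, add_mul]
    exact add_le_add (mul_le_mul_of_nonneg_left (hU' _ hlm) (abs_nonneg x))
      (mul_le_mul_of_nonneg_left (hV _ hlm) (abs_nonneg y))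
  have hc : (1 + lam) * ‖c‖ ≤ (1 + B) * C₀ * ‖V 0‖ := by
    have h1 := hcomb p.β₁' p.β₂'
    rw [← h.boundary] at h1
    have h2 := hcomb p.β₁ p.β₂
    rw [← norm_neg, ← h.dynamic, norm_mul, Complex.norm_real, Real.norm_of_nonneg hlam.le] at h2
    have : 0 ≤ C₀ * ‖V 0‖ := by positivity
    simp only [B]
    nlinarith
  refine ⟨fun z hz => (hV z hz).trans hle, fun z hz => (hU z hz).trans hle, hc, fun Φ hΦ =>
    norm_le_of_represents hρ hΦ (fun z hz => (hU' z hz).trans hle) (le_trans ?_ hc)⟩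
  exact le_mul_of_one_le_left (norm_nonneg _) (by linarith)

theorem exists_modeBounds (hl : 0 < p.ℓ) (hρ : 0 < p.ρ) (hA : APositive p)
    {Ψ : eigenvalues p → BBSpace p} {ψ : eigenvalues p → ℝ → ℂ} {ψb : eigenvalues p → ℂ}
    (hΨ : IsEigenSystem p Ψ ψ ψb) (hon : Orthonormal ℂ Ψ) :
    ∃ V b K, ModeBounds p ψ ψb V b K := by
  choose U V hM hUψ using fun lam =>
    exists_isMode hl hρ (hΨ.eigen lam) (hΨ.continuousOn lam) (hΨ.represents lam)
  have hpos := hΨ.pos hA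
  have hrep : ∀ lam, Represents p (Ψ lam) (U lam) (ψb lam) := fun lam => by
    refine (hΨ.represents lam).trans ((ae_bbMeasure_iff hρ).2 ⟨?_, rfl⟩)
    filter_upwards [ae_restrict_mem measurableSet_Ioo] with z hz
    exact (hUψ lam (Ioo_subset_Icc_self hz)).symm
  obtain ⟨C, M, hC, hM0, hbd⟩ := IsMode.exists_bound hl hρ
  set b : eigenvalues p → ℝ := fun lam => ‖V lam 0‖ / (1 + lam)
  have hsum : Summable fun lam => b lam ^ 2 :=
    exists_square_summable_bound hl hρ hon hpos hM hrep
  have hb0 : ∀ lam, 0 ≤ b lam := fun lam => div_nonneg (norm_nonneg _) (by linarith [hpos lam])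
  have hab : ∀ lam : eigenvalues p, ‖V lam 0‖ = (1 + lam) * b lam := fun lam => by
    have : 1 + (lam : ℝ) ≠ 0 := by linarith [hpos lam]
    simp only [b]; field_simp
  have hone : ∀ lam : eigenvalues p, 1 ≤ M * (C * ((1 + lam) * b lam)) := fun lam => by
    rw [← hab, ← hΨ.norm_one lam]
    exact (hbd (hpos lam) (hM lam)).2.2.2 _ (hrep lam)
  -- A spectral gap at zero: normalisation bounds `b` from below when `lam < 1`, so square
  -- summability leaves finitely many such eigenvalues, each positive.
  obtain ⟨κ, hκ1, hκ⟩ : ∃ κ : ℝ, 1 ≤ κ ∧ ∀ lam : eigenvalues p, 1 + (lam : ℝ) ≤ κ * lam := by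
    have hfin : {lam : eigenvalues p | (lam : ℝ) < 1}.Finite := by
      have h0 : (0 : ℝ) < (2 * M * C + 1)⁻¹ ^ 2 := by positivity
      refine (Filter.eventually_cofinite.1
        (hsum.tendsto_cofinite_zero.eventually_lt_const h0)).subset fun lam hlam hlt => ?_
      have h1 : b lam < (2 * M * C + 1)⁻¹ := lt_of_pow_lt_pow_left₀ 2 (by positivity) hlt
      have h2 := hone lam
      have h3 : M * (C * ((1 + lam) * b lam)) ≤ M * (C * (2 * b lam)) := by
        have := hb0 lam
        have hlam' : (lam : ℝ) < 1 := hlam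
        gcongr; linarith
      have h4 : (2 * M * C + 1) * b lam < 1 := by
        rw [← lt_div_iff₀' (by positivity), one_div]; exact h1
      nlinarith [hb0 lam]
    obtain ⟨B, hB⟩ := (Set.Finite.image (fun lam : eigenvalues p => 1 / (lam : ℝ)) hfin).bddAbove
    refine ⟨1 + max B 1, by linarith [le_max_right B 1], fun lam => ?_⟩
    have hl0 := hpos lam
    rcases lt_or_ge (lam : ℝ) 1 with h | h
    · have h1 : 1 / (lam : ℝ) ≤ B := hB ⟨lam, h, rfl⟩
      rw [div_le_iff₀ hl0] at h1
      nlinarith [le_max_left B 1]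
    · nlinarith [le_max_right B 1]
  have hκω : ∀ lam : eigenvalues p, 1 + (lam : ℝ) ≤ κ * freq lam ^ 2 := fun lam => by
    rw [hΨ.freq_sq hA]; exact hκ lam
  have hsω : ∀ lam : eigenvalues p, Real.sqrt (1 + lam) ≤ κ * freq lam := fun lam => by
    have h0 := (hΨ.freq_pos hA lam).le
    rw [Real.sqrt_le_left (by positivity)]
    refine (hκω lam).trans ?_
    rw [mul_pow]
    gcongr
    nlinarith
  have hs1 : ∀ lam : eigenvalues p, 1 ≤ Real.sqrt (1 + lam) := fun lam =>
    Real.one_le_sqrt.2 (by linarith [hpos lam])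
  have hss : ∀ lam : eigenvalues p, 1 + (lam : ℝ) = Real.sqrt (1 + lam) * Real.sqrt (1 + lam) :=
    fun lam => (Real.mul_self_sqrt (by linarith [hpos lam])).symm
  set K := (1 + M) * C * κ
  have hK : C * κ ≤ K := by
    simp only [K]; nlinarith [mul_nonneg (mul_nonneg hM0 hC) (zero_le_one.trans hκ1)]
  have hK2 : ∀ lam : eigenvalues p, C * ((1 + lam) * b lam) ≤ K * (freq lam ^ 2 * b lam) :=
    fun lam => by
      have := hb0 lam
      calc C * ((1 + lam) * b lam) ≤ C * (κ * freq lam ^ 2 * b lam) := by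
            gcongr; exact hκω lam
        _ = C * κ * (freq lam ^ 2 * b lam) := by ring
        _ ≤ _ := by gcongr
  have hK1 : ∀ lam : eigenvalues p, C * (Real.sqrt (1 + lam) * b lam) ≤ K * (freq lam * b lam) :=
    fun lam => by
      have := hb0 lam
      have := (hΨ.freq_pos hA lam).le
      calc C * (Real.sqrt (1 + lam) * b lam) ≤ C * (κ * freq lam * b lam) := by
            gcongr; exact hsω lam
        _ = C * κ * (freq lam * b lam) := by ring
        _ ≤ _ := by gcongr
  have hbulk : ∀ lam, ∀ z ∈ Icc 0 p.ℓ, ‖ψ lam z‖ ≤ C * (Real.sqrt (1 + lam) * b lam) := by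
    intro lam z hz
    have h1 := (hbd (hpos lam) (hM lam)).2.1 z hz
    rw [hUψ lam hz, hab] at h1
    refine le_of_mul_le_mul_left (h1.trans_eq ?_) (zero_lt_one.trans_le (hs1 lam))
    nth_rw 1 [hss lam]; ring
  have hbdry : ∀ lam, ‖ψb lam‖ ≤ C * (Real.sqrt (1 + lam) * b lam) := by
    intro lam
    have h1 := (hbd (hpos lam) (hM lam)).2.2.1
    rw [hab] at h1
    have h2 : ‖ψb lam‖ ≤ C * b lam :=
      le_of_mul_le_mul_left (h1.trans_eq (by ring)) (show 0 < 1 + (lam : ℝ) by linarith [hpos lam])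
    refine h2.trans ?_
    gcongr
    exact le_mul_of_one_le_left (hb0 lam) (hs1 lam)
  have h12 : ∀ lam : eigenvalues p,
      C * (Real.sqrt (1 + lam) * b lam) ≤ C * ((1 + lam) * b lam) := fun lam => by
    have := hb0 lam
    nth_rw 2 [hss lam]
    gcongr
    exact le_mul_of_one_le_left (Real.sqrt_nonneg _) (hs1 lam)
  have hVc := fun lam => continuousOn_iff_continuous_domRestrict.1 (hM lam).continuousOn_V
  -- Extended by constants, the derivative stays continuous and obeys the same bound on all of `ℝ`.
  refine ⟨fun lam => IccExtend hl.le (domRestrict (Icc 0 p.ℓ) (V lam)), b, K, by positivity, hb0,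
    hsum, fun lam => ?_, fun lam z hz => (hbulk lam z hz).trans (hK1 lam),
    fun lam z hz => (hbulk lam z hz).trans ((h12 lam).trans (hK2 lam)),
    fun lam => (hbdry lam).trans (hK1 lam),
    fun lam => (hbdry lam).trans ((h12 lam).trans (hK2 lam)), fun lam z => ?_,
    fun lam => (hVc lam).Icc_extend', fun lam z hz => ?_⟩
  · refine (hone lam).trans ?_
    have := hb0 lam
    calc M * (C * ((1 + lam) * b lam)) ≤ M * (C * (κ * freq lam ^ 2 * b lam)) := by
          gcongr; exact hκω lam
      _ = M * C * κ * (freq lam ^ 2 * b lam) := by ring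
      _ ≤ _ := by
        gcongr
        simp only [K]
        nlinarith [mul_nonneg hC (zero_le_one.trans hκ1)]
  · refine le_trans ?_ (hK2 lam)
    rw [← hab]
    exact (hbd (hpos lam) (hM lam)).1 _ (projIcc 0 p.ℓ hl.le z).2
  · rw [← hUψ lam hz]
    have : ∫ y in (0 : ℝ)..z, IccExtend hl.le (domRestrict (Icc 0 p.ℓ) (V lam)) y =
        ∫ y in (0 : ℝ)..z, V lam y := by
      refine intervalIntegral.integral_congr fun y hy => ?_
      rw [uIcc_of_le hz.1] at hy
      exact IccExtend_of_mem hl.le _ ⟨hy.1, hy.2.trans hz.2⟩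
    rw [this, intervalIntegral.integral_eq_sub_of_hasDerivAt
      (fun y _ => (hM lam).hasDerivAt_U y), (hM lam).dirichlet, sub_zero]
    refine ContinuousOn.intervalIntegrable ((hM lam).continuousOn_V.mono ?_)
    rw [uIcc_of_le hz.1]
    exact Icc_subset_Icc_right hz.2

/-! ### Time integrals of a single mode -/

theorem continuous_integral_cos_mul {G : ℝ → ℂ} (hG : Integrable G) (ω : ℝ) :
    Continuous fun t => ∫ t', ((Real.cos (ω * (t - t')) : ℝ) : ℂ) * G t' := by
  refine continuous_of_dominated (bound := fun t' => ‖G t'‖) (fun t => ?_) (fun t => ?_) hG.norm ?_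
  · exact (by fun_prop : Continuous fun t' : ℝ =>
      ((Real.cos (ω * (t - t')) : ℝ) : ℂ)).aestronglyMeasurable.mul hG.1
  · refine .of_forall fun t' => ?_
    rw [norm_mul, Complex.norm_real]
    exact mul_le_of_le_one_left (norm_nonneg _) (Real.abs_cos_le_one _)
  · exact .of_forall fun t' => by fun_prop

theorem norm_sin_div_mul_le {ω : ℝ} (hω : 0 < ω) (s : ℝ) (x : ℂ) :
    ‖((1 / ω * Real.sin (ω * s) : ℝ) : ℂ) * x‖ ≤ 1 / ω * ‖x‖ := by
  rw [norm_mul, Complex.norm_real, norm_mul, Real.norm_of_nonneg (by positivity : 0 ≤ 1 / ω)]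
  gcongr
  exact mul_le_of_le_one_right (by positivity) (Real.abs_sin_le_one _)

theorem integrable_sin_div_mul {G : ℝ → ℂ} (hG : Integrable G) {ω : ℝ} (hω : 0 < ω) (t : ℝ) :
    Integrable fun t' => ((1 / ω * Real.sin (ω * (t - t')) : ℝ) : ℂ) * G t' :=
  (hG.norm.const_mul (1 / ω)).mono'
    ((by fun_prop : Continuous fun t' : ℝ =>
      ((1 / ω * Real.sin (ω * (t - t')) : ℝ) : ℂ)).aestronglyMeasurable.mul hG.1)
    (.of_forall fun _ => norm_sin_div_mul_le hω _ _)

theorem hasDerivAt_integral_sin_mul {G : ℝ → ℂ} (hG : Integrable G) {ω : ℝ} (hω : 0 < ω) (t : ℝ) :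
    HasDerivAt (fun t => ∫ t', ((1 / ω * Real.sin (ω * (t - t')) : ℝ) : ℂ) * G t')
      (∫ t', ((Real.cos (ω * (t - t')) : ℝ) : ℂ) * G t') t := by
  refine (hasDerivAt_integral_of_dominated_loc_of_deriv_le (s := univ) (x₀ := t)
    (F := fun t t' => ((1 / ω * Real.sin (ω * (t - t')) : ℝ) : ℂ) * G t')
    (F' := fun t t' => ((Real.cos (ω * (t - t')) : ℝ) : ℂ) * G t')
    (bound := fun t' => ‖G t'‖) Filter.univ_mem ?_ (integrable_sin_div_mul hG hω t) ?_ ?_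
    hG.norm ?_).2
  · exact .of_forall fun s => (integrable_sin_div_mul hG hω s).1
  · exact (by fun_prop : Continuous fun t' : ℝ =>
      ((Real.cos (ω * (t - t')) : ℝ) : ℂ)).aestronglyMeasurable.mul hG.1
  · refine .of_forall fun t' s _ => ?_
    rw [norm_mul, Complex.norm_real]
    exact mul_le_of_le_one_left (norm_nonneg _) (Real.abs_cos_le_one _)
  · refine .of_forall fun t' s _ => ?_
    have h0 : HasDerivAt (fun s : ℝ => ω * (s - t')) ω s := by
      simpa using ((hasDerivAt_id s).sub_const t').const_mul ω
    have h1 : HasDerivAt (fun s : ℝ => 1 / ω * Real.sin (ω * (s - t')))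
        (Real.cos (ω * (s - t'))) s := by
      convert! (h0.sin).const_mul (1 / ω) using 1
      field_simp
    exact h1.ofReal_comp.mul_const _

/-! ### Mode amplitudes and their dominated series -/

/-- The amplitude of the `lam`-th mode at time `t`. -/
noncomputable def modeAmp (Ψ : eigenvalues p → BBSpace p) (f : ℝ → BBSpace p)
    (lam : eigenvalues p) (t : ℝ) : ℂ :=
  ∫ t', modeCoeff Ψ f t t' lam

/-- The time derivative of the amplitude of the `lam`-th mode. -/
noncomputable def modeAmpDeriv (Ψ : eigenvalues p → BBSpace p) (f : ℝ → BBSpace p)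
    (lam : eigenvalues p) (t : ℝ) : ℂ :=
  ∫ t', ((Real.cos (freq lam * (t - t')) : ℝ) : ℂ) * inner ℂ (Ψ lam) (f t')

/-- The total strength with which the source excites the `lam`-th mode. -/
noncomputable def modeMass (Ψ : eigenvalues p → BBSpace p) (f : ℝ → BBSpace p)
    (lam : eigenvalues p) : ℝ :=
  ∫ t', ‖inner ℂ (Ψ lam) (f t')‖

/-- A source `f` together with `g = √A f`, tested against an orthonormal system of modes with
square summable weights `b`. -/
structure IsModeSource (Ψ : eigenvalues p → BBSpace p) (b : eigenvalues p → ℝ)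
    (f g : ℝ → BBSpace p) : Prop where
  orthonormal : Orthonormal ℂ Ψ
  freq_pos : ∀ lam : eigenvalues p, 0 < freq lam
  b_nonneg : ∀ lam, 0 ≤ b lam
  summable : Summable fun lam => b lam ^ 2
  b_pos : ∀ lam, b lam ≠ 0
  continuous_f : Continuous f
  compact_f : HasCompactSupport f
  continuous_g : Continuous g
  compact_g : HasCompactSupport g
  inner_eq : ∀ t lam, inner ℂ (Ψ lam) (g t) = freq lam * inner ℂ (Ψ lam) (f t)

namespace IsModeSource

variable {Ψ : eigenvalues p → BBSpace p} {b : eigenvalues p → ℝ} {f g : ℝ → BBSpace p}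

/-- A summable family with no zero term has a countable index set; this permits exchanging sums with
integrals and a.e. statements. -/
theorem countable (h : IsModeSource Ψ b f g) : Countable (eigenvalues p) := by
  have h1 := h.summable.countable_support
  have h2 : Function.support (fun lam => b lam ^ 2) = univ :=
    eq_univ_of_forall fun lam => pow_ne_zero 2 (h.b_pos lam)
  rw [h2] at h1
  exact countable_univ_iff.1 h1

theorem integrable_inner (h : IsModeSource Ψ b f g) (lam : eigenvalues p) :
    Integrable fun t => inner ℂ (Ψ lam) (f t) := by
  refine Continuous.integrable_of_hasCompactSupport (continuous_const.inner h.continuous_f) ?_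
  exact h.compact_f.comp_left (g := fun x => inner ℂ (Ψ lam) x) (inner_zero_right _)

theorem norm_inner_mul_freq (h : IsModeSource Ψ b f g) (t : ℝ) (lam : eigenvalues p) :
    ‖inner ℂ (Ψ lam) (f t)‖ * (freq lam * b lam) = ‖inner ℂ (Ψ lam) (g t)‖ * b lam := by
  rw [h.inner_eq, norm_mul, Complex.norm_real, Real.norm_of_nonneg (h.freq_pos lam).le]
  ring

/-- The hypothesis `f t ∈ D(√A)` enters here: the factor `ω` is absorbed into `g`, then
Cauchy-Schwarz and Bessel apply. -/
theorem sum_le (h : IsModeSource Ψ b f g) (s : Finset (eigenvalues p)) (t : ℝ) :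
    ∑ lam ∈ s, ‖inner ℂ (Ψ lam) (f t)‖ * (freq lam * b lam) ≤
      ‖g t‖ * Real.sqrt (∑' lam, b lam ^ 2) := by
  simp_rw [h.norm_inner_mul_freq]
  refine (Real.sum_mul_le_sqrt_mul_sqrt _ _ _).trans ?_
  gcongr
  · exact Real.sqrt_le_iff.2 ⟨norm_nonneg _, h.orthonormal.sum_inner_products_le (g t)⟩
  · exact h.summable.sum_le_tsum s fun _ _ => sq_nonneg _

theorem summable_inner (h : IsModeSource Ψ b f g) (t : ℝ) :
    Summable fun lam => ‖inner ℂ (Ψ lam) (f t)‖ * (freq lam * b lam) :=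
  summable_of_sum_le (fun lam => mul_nonneg (norm_nonneg _)
    (mul_nonneg (h.freq_pos lam).le (h.b_nonneg lam))) fun s => h.sum_le s t

theorem summable_modeMass (h : IsModeSource Ψ b f g) :
    Summable fun lam => modeMass Ψ f lam * (freq lam * b lam) := by
  refine summable_of_sum_le (c := (∫ t, ‖g t‖) * Real.sqrt (∑' lam, b lam ^ 2))
    (fun lam => mul_nonneg (integral_nonneg fun _ => norm_nonneg _)
    (mul_nonneg (h.freq_pos lam).le (h.b_nonneg lam))) fun s => ?_
  have hint : ∀ lam ∈ s, Integrable fun t =>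
      ‖inner ℂ (Ψ lam) (f t)‖ * (freq lam * b lam) :=
    fun lam _ => (h.integrable_inner lam).norm.mul_const _
  simp_rw [modeMass, ← integral_mul_const]
  rw [← integral_finsetSum s hint]
  refine integral_mono (integrable_finsetSum s hint) ?_ fun t => h.sum_le s t
  exact (h.continuous_g.integrable_of_hasCompactSupport h.compact_g).norm.mul_const _

theorem norm_modeCoeff_le (h : IsModeSource Ψ b f g) (t t' : ℝ) (lam : eigenvalues p) :
    ‖modeCoeff Ψ f t t' lam‖ ≤ 1 / freq lam * ‖inner ℂ (Ψ lam) (f t')‖ :=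
  norm_sin_div_mul_le (h.freq_pos lam) _ _

theorem integrable_modeCoeff (h : IsModeSource Ψ b f g) (t : ℝ) (lam : eigenvalues p) :
    Integrable fun t' => modeCoeff Ψ f t t' lam :=
  integrable_sin_div_mul (h.integrable_inner lam) (h.freq_pos lam) t

theorem norm_modeAmp_le (h : IsModeSource Ψ b f g) (lam : eigenvalues p) (t : ℝ) :
    ‖modeAmp Ψ f lam t‖ ≤ 1 / freq lam * modeMass Ψ f lam := by
  rw [modeMass, ← integral_const_mul]
  exact norm_integral_le_of_norm_le ((h.integrable_inner lam).norm.const_mul _)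
    (.of_forall fun t' => h.norm_modeCoeff_le t t' lam)

theorem norm_modeAmpDeriv_le (h : IsModeSource Ψ b f g) (lam : eigenvalues p) (t : ℝ) :
    ‖modeAmpDeriv Ψ f lam t‖ ≤ modeMass Ψ f lam := by
  refine norm_integral_le_of_norm_le (h.integrable_inner lam).norm (.of_forall fun t' => ?_)
  rw [norm_mul, Complex.norm_real]
  exact mul_le_of_le_one_left (norm_nonneg _) (Real.abs_cos_le_one _)

theorem hasDerivAt_modeAmp (h : IsModeSource Ψ b f g) (lam : eigenvalues p) (t : ℝ) :
    HasDerivAt (modeAmp Ψ f lam) (modeAmpDeriv Ψ f lam t) t :=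
  hasDerivAt_integral_sin_mul (h.integrable_inner lam) (h.freq_pos lam) t

theorem continuous_modeAmp (h : IsModeSource Ψ b f g) (lam : eigenvalues p) :
    Continuous (modeAmp Ψ f lam) :=
  continuous_iff_continuousAt.2 fun t => (h.hasDerivAt_modeAmp lam t).continuousAt

theorem continuous_modeAmpDeriv (h : IsModeSource Ψ b f g) (lam : eigenvalues p) :
    Continuous (modeAmpDeriv Ψ f lam) :=
  continuous_integral_cos_mul (h.integrable_inner lam) _

section Series

variable {E : Type*} [NormedAddCommGroup E] [NormedSpace ℂ E] {x : eigenvalues p → E} {K : ℝ}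

/-- Allowing vectors `x lam` in any normed space treats the Hilbert space series and the pointwise
bulk and boundary series alike. -/
theorem norm_modeCoeff_smul_le (h : IsModeSource Ψ b f g)
    (hx : ∀ lam, ‖x lam‖ ≤ K * (freq lam ^ 2 * b lam)) (t t' : ℝ) (lam : eigenvalues p) :
    ‖modeCoeff Ψ f t t' lam • x lam‖ ≤
      K * (‖inner ℂ (Ψ lam) (f t')‖ * (freq lam * b lam)) := by
  have hω := h.freq_pos lam
  rw [norm_smul]
  calc _ ≤ 1 / freq lam * ‖inner ℂ (Ψ lam) (f t')‖ * (K * (freq lam ^ 2 * b lam)) := by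
        gcongr
        · exact h.norm_modeCoeff_le t t' lam
        · exact hx lam
    _ = _ := by field_simp

theorem norm_modeAmp_smul_le (h : IsModeSource Ψ b f g)
    (hx : ∀ lam, ‖x lam‖ ≤ K * (freq lam ^ 2 * b lam)) (t : ℝ) (lam : eigenvalues p) :
    ‖modeAmp Ψ f lam t • x lam‖ ≤ K * (modeMass Ψ f lam * (freq lam * b lam)) := by
  have hω := h.freq_pos lam
  rw [norm_smul]
  calc _ ≤ 1 / freq lam * modeMass Ψ f lam * (K * (freq lam ^ 2 * b lam)) :=
        mul_le_mul (h.norm_modeAmp_le lam t) (hx lam) (norm_nonneg _)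
          ((norm_nonneg _).trans (h.norm_modeAmp_le lam t))
    _ = _ := by field_simp

theorem norm_modeAmpDeriv_smul_le (h : IsModeSource Ψ b f g)
    (hx : ∀ lam, ‖x lam‖ ≤ K * (freq lam * b lam)) (t : ℝ) (lam : eigenvalues p) :
    ‖modeAmpDeriv Ψ f lam t • x lam‖ ≤ K * (modeMass Ψ f lam * (freq lam * b lam)) := by
  rw [norm_smul]
  calc _ ≤ modeMass Ψ f lam * (K * (freq lam * b lam)) :=
        mul_le_mul (h.norm_modeAmpDeriv_le lam t) (hx lam) (norm_nonneg _)
          ((norm_nonneg _).trans (h.norm_modeAmpDeriv_le lam t))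
    _ = _ := by ring

theorem summable_norm_modeCoeff_smul (h : IsModeSource Ψ b f g)
    (hx : ∀ lam, ‖x lam‖ ≤ K * (freq lam ^ 2 * b lam)) (t t' : ℝ) :
    Summable fun lam => ‖modeCoeff Ψ f t t' lam • x lam‖ :=
  .of_nonneg_of_le (fun _ => norm_nonneg _) (h.norm_modeCoeff_smul_le hx t t')
    ((h.summable_inner t').mul_left K)

theorem summable_norm_modeAmp_smul (h : IsModeSource Ψ b f g)
    (hx : ∀ lam, ‖x lam‖ ≤ K * (freq lam ^ 2 * b lam)) (t : ℝ) :
    Summable fun lam => ‖modeAmp Ψ f lam t • x lam‖ :=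
  .of_nonneg_of_le (fun _ => norm_nonneg _) (h.norm_modeAmp_smul_le hx t)
    (h.summable_modeMass.mul_left K)

variable [CompleteSpace E]

theorem integrable_tsum (h : IsModeSource Ψ b f g) (hK : 0 ≤ K)
    (hx : ∀ lam, ‖x lam‖ ≤ K * (freq lam ^ 2 * b lam)) (t : ℝ) :
    Integrable fun t' => ∑' lam, modeCoeff Ψ f t t' lam • x lam := by
  have := h.countable
  refine ((h.continuous_g.integrable_of_hasCompactSupport h.compact_g).norm.mul_const
    (Real.sqrt (∑' lam, b lam ^ 2))).const_mul K |>.mono' ?_ (.of_forall fun t' => ?_)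
  · refine aestronglyMeasurable_of_tendsto_ae (Filter.atTop)
      (f := fun (s : Finset (eigenvalues p)) t' => ∑ lam ∈ s, modeCoeff Ψ f t t' lam • x lam)
      (fun s => ?_) (.of_forall fun t' =>
        (h.summable_norm_modeCoeff_smul hx t t').of_norm.hasSum)
    exact (integrable_finsetSum s fun lam _ => (h.integrable_modeCoeff t lam).smul_const _).1
  · refine (tsum_of_norm_bounded ((h.summable_inner t').mul_left K).hasSum
      (h.norm_modeCoeff_smul_le hx t t')).trans ?_
    rw [tsum_mul_left]
    gcongr
    exact (h.summable_inner t').tsum_le_of_sum_le fun s => h.sum_le s t'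

theorem integral_tsum_eq (h : IsModeSource Ψ b f g)
    (hx : ∀ lam, ‖x lam‖ ≤ K * (freq lam ^ 2 * b lam)) (t : ℝ) :
    ∫ t', ∑' lam, modeCoeff Ψ f t t' lam • x lam = ∑' lam, modeAmp Ψ f lam t • x lam := by
  have := h.countable
  rw [← integral_tsum_of_summable_integral_norm]
  · simp_rw [integral_smul_const]; rfl
  · exact fun lam => (h.integrable_modeCoeff t lam).smul_const _
  · refine .of_nonneg_of_le (fun _ => integral_nonneg fun _ => norm_nonneg _) (fun lam => ?_)
      (h.summable_modeMass.mul_left K)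
    rw [modeMass, ← integral_mul_const, ← integral_const_mul]
    exact integral_mono ((h.integrable_modeCoeff t lam).smul_const _).norm
      (((h.integrable_inner lam).norm.mul_const _).const_mul _)
      fun t' => h.norm_modeCoeff_smul_le hx t t' lam

theorem hasDerivAt_tsum_modeAmp (h : IsModeSource Ψ b f g)
    (hx : ∀ lam, ‖x lam‖ ≤ K * (freq lam * b lam))
    (hx' : ∀ lam, ‖x lam‖ ≤ K * (freq lam ^ 2 * b lam)) (t : ℝ) :
    HasDerivAt (fun s => ∑' lam, modeAmp Ψ f lam s • x lam)
      (∑' lam, modeAmpDeriv Ψ f lam t • x lam) t :=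
  hasDerivAt_tsum (h.summable_modeMass.mul_left K)
    (fun lam t => (h.hasDerivAt_modeAmp lam t).smul_const (x lam))
    (fun lam t => h.norm_modeAmpDeriv_smul_le hx t lam)
    -- Termwise differentiation needs convergence of the undifferentiated series at one point only;
    -- time `0` is used.
    (h.summable_norm_modeAmp_smul hx' 0).of_norm t

end Series

end IsModeSource

end DynBC

/-! ### Convergence and regularity of the field -/

open DynBC in
theorem mainTheorem4 (p : DynBC.Params) (hl : 0 < p.ℓ) (hρ : 0 < p.ρ)
    (hA : DynBC.APositive p)
    (Ψ : DynBC.eigenvalues p → DynBC.BBSpace p) (ψ : DynBC.eigenvalues p → ℝ → ℂ)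
    (ψb : DynBC.eigenvalues p → ℂ) (hΨ : DynBC.IsEigenSystem p Ψ ψ ψb)
    (f : ℝ → DynBC.BBSpace p) (hf : DynBC.IsTestFunction p f) :
    DynBC.FieldConverges Ψ ψ ψb f ∧
    (∀ t, DynBC.Represents p (DynBC.solution Ψ f t)
      (DynBC.bulkField Ψ ψ f t) (DynBC.boundaryField Ψ ψb f t)) ∧
    ∃ (φt φz : ℝ → ℝ → ℂ) (φbt : ℝ → ℂ) (C : ℝ),
      (∀ t, ∀ z ∈ Set.Icc 0 p.ℓ,
        HasDerivAt (fun s => DynBC.bulkField Ψ ψ f s z) (φt t z) t) ∧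
      (∀ t, ∀ z ∈ Set.Icc 0 p.ℓ,
        HasDerivWithinAt (fun y => DynBC.bulkField Ψ ψ f t y) (φz t z) (Set.Icc 0 p.ℓ) z) ∧
      (∀ t, HasDerivAt (DynBC.boundaryField Ψ ψb f) (φbt t) t) ∧
      ContinuousOn (fun x : ℝ × ℝ => φt x.1 x.2) (Set.univ ×ˢ Set.Icc 0 p.ℓ) ∧
      ContinuousOn (fun x : ℝ × ℝ => φz x.1 x.2) (Set.univ ×ˢ Set.Icc 0 p.ℓ) ∧
      Continuous φbt ∧
      (∀ t, ∀ z ∈ Set.Icc 0 p.ℓ, ‖φt t z‖ ≤ C ∧ ‖φz t z‖ ≤ C) ∧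
      (∀ t, ‖φbt t‖ ≤ C) := by
  obtain ⟨hfc, -, g, hg, hfcont, hgcont⟩ := hf
  have hon := hΨ.orthonormal hA (hg 0)
  obtain ⟨V, b, K, hB⟩ := exists_modeBounds hl hρ hA hΨ hon
  have h : IsModeSource Ψ b f g :=
    { orthonormal := hon
      freq_pos := hΨ.freq_pos hA
      b_nonneg := hB.b_nonneg
      summable := hB.summable
      b_pos := fun lam h0 => by have := hB.one_le lam; simp [h0] at this; linarith
      continuous_f := hfcont
      compact_f := hfc
      continuous_g := hgcont
      -- By linearity `√A f` vanishes wherever `f` does.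
      compact_g := hfc.mono fun t ht => by
        contrapose! ht
        rw [Function.notMem_support] at ht ⊢
        obtain ⟨S, -, hS⟩ := hg t
        exact S.graph_fst_eq_zero_snd hS ht
      inner_eq := fun t lam => hΨ.inner_sqrt hA (hg t) lam }
  have := h.countable
  have hΨn : ∀ lam, ‖Ψ lam‖ ≤ K * (freq lam ^ 2 * b lam) := fun lam => by
    rw [hΨ.norm_one]; exact hB.one_le lam
  have hψ : ∀ z ∈ Icc 0 p.ℓ, ∀ lam, ‖ψ lam z‖ ≤ K * (freq lam * b lam) :=
    fun z hz lam => hB.bulk_le lam z hz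
  have hψ' : ∀ z ∈ Icc 0 p.ℓ, ∀ lam, ‖ψ lam z‖ ≤ K * (freq lam ^ 2 * b lam) :=
    fun z hz lam => hB.bulk_le' lam z hz
  have hbulk : ∀ t, ∀ z ∈ Icc 0 p.ℓ,
      bulkField Ψ ψ f t z = -∑' lam, modeAmp Ψ f lam t * ψ lam z :=
    fun t z hz => congrArg Neg.neg (h.integral_tsum_eq (hψ' z hz) t)
  have hbdry : ∀ t, boundaryField Ψ ψb f t = -∑' lam, modeAmp Ψ f lam t * ψb lam :=
    fun t => congrArg Neg.neg (h.integral_tsum_eq hB.boundary_le' t)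
  have hsol : ∀ t, solution Ψ f t = -∑' lam, modeAmp Ψ f lam t • Ψ lam := fun t => by
    rw [← h.integral_tsum_eq hΨn t, ← integral_neg]; rfl
  have hS := h.summable_modeMass.mul_left K
  refine ⟨⟨fun t t' => (h.summable_norm_modeCoeff_smul hΨn t t').of_norm,
    fun t => (h.integrable_tsum hB.K_nonneg hΨn t).neg,
    fun t t' z hz => (h.summable_norm_modeCoeff_smul (hψ' z hz) t t').of_norm,
    fun t z hz => h.integrable_tsum hB.K_nonneg (hψ' z hz) t,
    fun t t' => (h.summable_norm_modeCoeff_smul hB.boundary_le' t t').of_norm,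
    fun t => h.integrable_tsum hB.K_nonneg hB.boundary_le' t⟩, fun t => ?_,
    fun t z => -∑' lam, modeAmpDeriv Ψ f lam t * ψ lam z,
    fun t z => -∑' lam, modeAmp Ψ f lam t * V lam z,
    fun t => -∑' lam, modeAmpDeriv Ψ f lam t * ψb lam,
    ∑' lam, K * (modeMass Ψ f lam * (freq lam * b lam)),
    fun t z hz => ?_, fun t z hz => ?_, fun t => ?_, ?_, ?_, ?_, fun t z hz => ⟨?_, ?_⟩, fun t => ?_⟩
  · rw [hsol, Represents]
    -- Absolute convergence in `L²` implies that the pointwise series converges a.e. to the `L²`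
    -- sum, which identifies the two definitions of the field.
    have hne : ∑' lam, ‖modeAmp Ψ f lam t • Ψ lam‖ₑ ≠ ⊤ :=
      tsum_enorm_ne_top_iff_summable_norm.2 (h.summable_norm_modeAmp_smul hΨn t)
    have hpt : ∀ᵐ x ∂bbMeasure p, ∀ lam,
        (modeAmp Ψ f lam t • Ψ lam : BBSpace p) x =
          modeAmp Ψ f lam t * bb (ψ lam) (ψb lam) x := by
      refine ae_all_iff.2 fun lam => ?_
      filter_upwards [Lp.coeFn_smul (modeAmp Ψ f lam t) (Ψ lam), hΨ.represents lam] with x h1 h2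
      rw [h1, Pi.smul_apply, h2, smul_eq_mul]
    have hfield : ∀ᵐ x ∂bbMeasure p,
        -∑' lam, modeAmp Ψ f lam t * bb (ψ lam) (ψb lam) x =
          bb (bulkField Ψ ψ f t) (boundaryField Ψ ψb f t) x := by
      refine (ae_bbMeasure_iff hρ).2 ⟨?_, (hbdry t).symm⟩
      filter_upwards [ae_restrict_mem measurableSet_Ioo] with z hz
      exact (hbulk t z (Ioo_subset_Icc_self hz)).symm
    filter_upwards [Lp.coeFn_neg (∑' lam, modeAmp Ψ f lam t • Ψ lam), Lp.coeFn_tsum hne, hpt,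
      hfield] with x h1 h2 h3 h4
    rw [h1, Pi.neg_apply, h2, ← h4]
    simp_rw [h3]
  · exact ((h.hasDerivAt_tsum_modeAmp (hψ z hz) (hψ' z hz) t).neg).congr_of_eventuallyEq
      (.of_forall fun s => hbulk s z hz)
  · have h1 : ∀ lam y, HasDerivAt (fun y => modeAmp Ψ f lam t * ∫ s in (0 : ℝ)..y, V lam s)
        (modeAmp Ψ f lam t * V lam y) y := fun lam y =>
      (((hB.continuous_deriv lam).integral_hasStrictDerivAt 0 y).hasDerivAt).const_mul _
    -- At `y₀ = 0` every primitive vanishes, so convergence at the base point is trivial.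
    have h2 := hasDerivAt_tsum (y₀ := 0) hS h1
      (fun lam y => h.norm_modeAmp_smul_le (fun lam => hB.deriv_le lam y) t lam)
      (by simp) z
    refine h2.neg.hasDerivWithinAt.congr_of_mem (fun y hy => ?_) hz
    rw [hbulk t y hy, Pi.neg_apply]
    simp_rw [hB.primitive _ y hy]
  · exact ((h.hasDerivAt_tsum_modeAmp hB.boundary_le hB.boundary_le' t).neg).congr_of_eventuallyEq
      (.of_forall hbdry)
  · refine (continuousOn_tsum (fun lam => ?_) hS fun lam x hx =>
      h.norm_modeAmpDeriv_smul_le (hψ x.2 hx.2) x.1 lam).neg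
    exact ((h.continuous_modeAmpDeriv lam).comp continuous_fst).continuousOn.mul
      ((hΨ.continuousOn lam).comp continuousOn_snd fun x hx => hx.2)
  · refine (continuousOn_tsum (fun lam => ?_) hS fun lam x _ =>
      h.norm_modeAmp_smul_le (fun lam => hB.deriv_le lam x.2) x.1 lam).neg
    exact (((h.continuous_modeAmp lam).comp continuous_fst).mul
      ((hB.continuous_deriv lam).comp continuous_snd)).continuousOn
  · exact (continuous_tsum (fun lam => (h.continuous_modeAmpDeriv lam).mul continuous_const) hS
      fun lam t => h.norm_modeAmpDeriv_smul_le hB.boundary_le t lam).neg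
  · rw [norm_neg]
    exact tsum_of_norm_bounded hS.hasSum (h.norm_modeAmpDeriv_smul_le (hψ z hz) t)
  · rw [norm_neg]
    exact tsum_of_norm_bounded hS.hasSum
      (h.norm_modeAmp_smul_le (fun lam => hB.deriv_le lam z) t)
  · rw [norm_neg]
    exact tsum_of_norm_bounded hS.hasSum (h.norm_modeAmpDeriv_smul_le hB.boundary_le t)
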